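/- A $*$-probability space is a unital complex $*$-algebra $\mathcal A$ with a linear functional $\varphi:\mathcal A\to\mathbb C$ such that $\varphi(1)=1$ and $\varphi(a^*)=\overline{\varphi(a)}$ for all $a\in\mathcal A$ (positivity is not required). For $\chi:\{1,\dots,n\}\to\{l,r\}$ let $\prec_\chi$ be the order on $\{1,\dots,n\}$ in which the elements of $\chi^{-1}(l)$ come first, in increasing order, followed by the elements of $\chi^{-1}(r)$ in decreasing order. Let $BNC(\chi)$ be the set of partitions of $\{1,\dots,n\}$ that are non-crossing for $\prec_\chi$. The bi-free cumulants $\kappa_\chi$ ($n\ge 1$) are determined by $$\varphi(a_1\cdots a_n)=\sum_{\pi\in BNC(\chi)}\prod_{V\in\pi}\kappa_{\chi|_V}\big((a_1,\dots,a_n)|_V\big).$$ A pair $(x,y)$ in $\mathcal A$ is $R$-diagonal if, for all $n\ge1$, all $\chi:\{1,\dots,n\}\to\{l,r\}$ and all $\omega:\{1,\dots,n\}\to\{1,*\}$, with $z_k=x^{\omega(k)}$ if $\chi(k)=l$ and $z_k=y^{\omega(k)}$ if $\chi(k)=r$, one has $\kappa_\chi(z_1,\dots,z_n)=0$ unless $n$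 is even and $\omega$ alternates between $1$ and $*$ along the order $\prec_\chi$. Two pairs $(b_1,c_1)$, $(b_2,c_2)$ are bi-free if the pairs of faces consisting of the unital algebras generated by $b_k$ (left) and by $c_k$ (right), $k=1,2$, are bi-free in the sense of Voiculescu. **Theorem 2.7.** There exist a $*$-probability space $(\mathcal A,\varphi)$ and an $R$-diagonal pair $(x,y)$ of elements of $\mathcal A$ such that $(xx^*,yy^*)$ and $(x^*x,y^*y)$ are not bi-free. Moreover, $(x,y)$ can be chosen such that $$\kappa_2(x,y^*)=\kappa_2(x^*,y)=\kappa_2(y,x^*)=\kappa_2(y^*,x)=1$$ (with $x,x^*$ on the left and $y,y^*$ on the right), while all other bi-free cumulants of $((x,x^*),(y,y^*))$, of every order $n\ge1$, vanish. -/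

import Mathlib

/-! ### Non-commutative probability spaces with involution -/

/-- `φ` makes the unital complex `*`-algebra `A` a `*`-probability space: it is linear, unital, and
satisfies `φ (a*) = conj (φ a)`. (No positivity is required.) -/
structure IsStarProbability {A : Type*} [Ring A] [StarRing A] [Algebra ℂ A] [StarModule ℂ A]
    (φ : A →ₗ[ℂ] ℂ) : Prop where
  map_one : φ 1 = 1
  map_star : ∀ a : A, φ (star a) = star (φ a)

/-- The two faces: left and right. -/
inductive Side where
  | l : Side
  | r : Side

/-! ### Bi-non-crossing partitions and bi-free cumulants -/

/-- The strict total order `≺_χ` on `{1, …, n}`: first the left positions in increasing order, then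
the right positions in decreasing order. -/
def chiLT {n : ℕ} (χ : Fin n → Side) (i j : Fin n) : Prop :=
  match χ i, χ j with
  | Side.l, Side.l => i < j
  | Side.l, Side.r => True
  | Side.r, Side.l => False
  | Side.r, Side.r => j < i

/-- A partition of a set `V` of positions is bi-non-crossing if it is non-crossing for the
order `≺_χ`: there are no `a ≺ b ≺ c ≺ d` with `a, c` in one block and `b, d` in a different one. -/
def IsBiNonCrossing {n : ℕ} (χ : Fin n → Side) {V : Finset (Fin n)} (π : Finpartition V) : Prop :=
  ∀ P ∈ π.parts, ∀ Q ∈ π.parts, ∀ a ∈ P, ∀ b ∈ Q, ∀ c ∈ P, ∀ d ∈ Q,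
    chiLT χ a b → chiLT χ b c → chiLT χ c d → P = Q

/-- The ordered product `a_{i₁} ⋯ a_{i_k}` for `V = {i₁ < ⋯ < i_k}`. -/
def orderedProd {A : Type*} [Ring A] {n : ℕ} (a : Fin n → A) (V : Finset (Fin n)) : A :=
  ((V.sort (· ≤ ·)).map a).prod

open Classical in
/-- The bi-free cumulant `κ_{χ|V}((a₁, …, aₙ)|V)` of the subtuple indexed by a non-empty set `V` of
positions. It is given recursively by the moment-cumulant formula
`φ(a_{i₁} ⋯ a_{i_k}) = ∑_{π ∈ BNC(χ|V)} ∏_{W ∈ π} κ_{χ|W}((a₁, …, aₙ)|W)`,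
solved for the term of the one-block partition; the sum below runs over the bi-non-crossing
partitions of `V` other than the one-block partition. -/
noncomputable def biFreeCumulantOn {A : Type*} [Ring A] [Algebra ℂ A] (φ : A →ₗ[ℂ] ℂ) {n : ℕ}
    (χ : Fin n → Side) (a : Fin n → A) (V : Finset (Fin n)) : ℂ :=
  φ (orderedProd a V) -
    ∑ π : {π : Finpartition V // IsBiNonCrossing χ π ∧ V ∉ π.parts},
      ∏ W : {W : Finset (Fin n) // W ∈ π.1.parts}, biFreeCumulantOn φ χ a W.1
termination_by V.card
decreasing_by
  exact Finset.card_lt_card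
    (lt_of_le_of_ne (π.1.le W.2) (fun h => π.2.2 (Eq.mp (congrArg (· ∈ π.1.parts) h) W.2)))

/-- The bi-free cumulant `κ_χ(a₁, …, aₙ)`. -/
noncomputable def biFreeCumulant {A : Type*} [Ring A] [Algebra ℂ A] (φ : A →ₗ[ℂ] ℂ) {n : ℕ}
    (χ : Fin n → Side) (a : Fin n → A) : ℂ :=
  biFreeCumulantOn φ χ a Finset.univ

/-! ### R-diagonal pairs -/

/-- The letter at a position on side `s`: `x` or `x*` on the left, `y` or `y*` on the right; the
letter is starred if and only if `e = true`. -/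
def starLetter {A : Type*} [Ring A] [StarRing A] (x y : A) (s : Side) (e : Bool) : A :=
  match s, e with
  | Side.l, false => x
  | Side.l, true => star x
  | Side.r, false => y
  | Side.r, true => star y

/-- The exponents `ω` alternate along the order `≺_χ`: any two consecutive positions for this order
carry different exponents. -/
def IsChiAlternating {n : ℕ} (χ : Fin n → Side) (ω : Fin n → Bool) : Prop :=
  ∀ i j : Fin n, chiLT χ i j → (∀ k : Fin n, ¬ (chiLT χ i k ∧ chiLT χ k j)) → ω i ≠ ω j

/-- The pair `(x, y)` is R-diagonal: a bi-free cumulant of `((x, x*), (y, y*))` vanishes unless it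
has even order and its entries, read in the order `≺_χ`, are alternatingly starred and
un-starred. -/
def IsRDiagonal {A : Type*} [Ring A] [StarRing A] [Algebra ℂ A] (φ : A →ₗ[ℂ] ℂ) (x y : A) : Prop :=
  ∀ (n : ℕ) (χ : Fin n → Side) (ω : Fin n → Bool), ¬ (Even n ∧ IsChiAlternating χ ω) →
    biFreeCumulant φ χ (fun k => starLetter x y (χ k) (ω k)) = 0

/-! ### Free products of vector spaces with a specified state vector -/

universe u

/-- A vector space with a specified state vector: a complex vector space `X = ℂ ξ ⊕ X°`, the
complement `X°` being given as the kernel of the functional `ψ` with `ψ ξ = 1`. -/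
structure StateSpace where
  carrier : Type u
  [addCommGroup : AddCommGroup carrier]
  [module : Module ℂ carrier]
  ξ : carrier
  ψ : carrier →ₗ[ℂ] ℂ
  ψ_ξ : ψ ξ = 1

attribute [instance] StateSpace.addCommGroup StateSpace.module

namespace StateSpace

/-- The complement `X°` of the line spanned by the state vector. -/
abbrev compl (X : StateSpace.{u}) : Submodule ℂ X.carrier := LinearMap.ker X.ψ

/-- The projection `X → X°` along the state vector. -/
def toCompl (X : StateSpace.{u}) : X.carrier →ₗ[ℂ] X.compl :=
  LinearMap.codRestrict X.compl (LinearMap.id - X.ψ.smulRight X.ξ)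
    (fun v => by simp [X.ψ_ξ])

section FreeProduct

variable {ι : Type*} (X : ι → StateSpace.{u})

/-- The tensor algebra of `⨁ i, X_i°`. The free product of the spaces `X_i` is the subspace
`freeProduct X` of it. -/
abbrev Fock := TensorAlgebra ℂ (DirectSum ι (fun i => (X i).compl))

/-- For `g : ⨁ i, X_i° → Fock X`, the operators `(f, d) ↦ (m f, g(m) f)`. -/
noncomputable def leftAct (g : DirectSum ι (fun i => (X i).compl) →ₗ[ℂ] Fock X) :
    DirectSum ι (fun i => (X i).compl) →ₗ[ℂ] Module.End ℂ (Fock X × Fock X) :=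
  LinearMap.mk₂ ℂ (fun m p => (TensorAlgebra.ι ℂ m * p.1, g m * p.1))
    (fun m m' p => by simp [add_mul]) (fun c m p => by simp)
    (fun m p p' => by simp [mul_add]) (fun c m p => by simp)

/-- For `g : ⨁ i, X_i° → Fock X`, the operators `(f, d) ↦ (f m, f g(m))`. -/
noncomputable def rightAct (g : DirectSum ι (fun i => (X i).compl) →ₗ[ℂ] Fock X) :
    DirectSum ι (fun i => (X i).compl) →ₗ[ℂ] Module.End ℂ (Fock X × Fock X) :=
  LinearMap.mk₂ ℂ (fun m p => (p.1 * TensorAlgebra.ι ℂ m, p.1 * g m))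
    (fun m m' p => by simp [mul_add]) (fun c m p => by simp)
    (fun m p p' => by simp [add_mul]) (fun c m p => by simp)

/-- The linear map `D` with `D 1 = d` and `D (m f) = g(m) f` for `m ∈ ⨁ i, X_i°`. -/
noncomputable def leftRec (d : Fock X)
    (g : DirectSum ι (fun i => (X i).compl) →ₗ[ℂ] Fock X) : Fock X →ₗ[ℂ] Fock X :=
  LinearMap.snd ℂ _ _ ∘ₗ LinearMap.applyₗ ((1 : Fock X), d) ∘ₗ
    (TensorAlgebra.lift ℂ (leftAct X g)).toLinearMap

/-- The linear map `D` with `D 1 = d` and `D (f m) = f g(m)` for `m ∈ ⨁ i, X_i°`. -/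
noncomputable def rightRec (d : Fock X)
    (g : DirectSum ι (fun i => (X i).compl) →ₗ[ℂ] Fock X) : Fock X →ₗ[ℂ] Fock X :=
  LinearMap.snd ℂ _ _ ∘ₗ LinearMap.applyₗ ((1 : Fock X), d) ∘ₗ
    (MulOpposite.opLinearEquiv ℂ).symm.toLinearMap ∘ₗ
    (TensorAlgebra.lift ℂ
      ((MulOpposite.opLinearEquiv ℂ).toLinearMap ∘ₗ rightAct X g)).toLinearMap

theorem leftRec_one (d : Fock X) (g : DirectSum ι (fun i => (X i).compl) →ₗ[ℂ] Fock X) :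
    leftRec X d g 1 = d := by
  simp [leftRec]

theorem leftRec_mul (d : Fock X) (g : DirectSum ι (fun i => (X i).compl) →ₗ[ℂ] Fock X)
    (m : DirectSum ι (fun i => (X i).compl)) (f : Fock X) :
    leftRec X d g (TensorAlgebra.ι ℂ m * f) = g m * f := by
  have key : ∀ f : Fock X, ((TensorAlgebra.lift ℂ (leftAct X g)) f ((1 : Fock X), d)).1 = f := by
    intro f
    have h : ∀ p : Fock X × Fock X, ((TensorAlgebra.lift ℂ (leftAct X g)) f p).1 = f * p.1 := by
      induction f using TensorAlgebra.induction with
      | algebraMap r => intro p; simp [Algebra.smul_def]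
      | ι m => intro p; simp [leftAct]
      | mul a b ha hb => intro p; simp [ha, hb, mul_assoc]
      | add a b ha hb => intro p; simp [ha, hb, add_mul]
    simpa using h (1, d)
  have h : leftRec X d g (TensorAlgebra.ι ℂ m * f) =
      g m * ((TensorAlgebra.lift ℂ (leftAct X g)) f ((1 : Fock X), d)).1 := by
    simp [leftRec, show ∀ p, leftAct X g m p = (TensorAlgebra.ι ℂ m * p.1, g m * p.1) from
      fun _ => rfl]
  rw [h, key]

theorem rightRec_one (d : Fock X) (g : DirectSum ι (fun i => (X i).compl) →ₗ[ℂ] Fock X) :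
    rightRec X d g 1 = d := by
  simp [rightRec]

theorem rightRec_mul (d : Fock X) (g : DirectSum ι (fun i => (X i).compl) →ₗ[ℂ] Fock X)
    (m : DirectSum ι (fun i => (X i).compl)) (f : Fock X) :
    rightRec X d g (f * TensorAlgebra.ι ℂ m) = f * g m := by
  have key : ∀ f : Fock X, (((TensorAlgebra.lift ℂ ((MulOpposite.opLinearEquiv ℂ).toLinearMap ∘ₗ
      rightAct X g)) f).unop ((1 : Fock X), d)).1 = f := by
    intro f
    have h : ∀ p : Fock X × Fock X, (((TensorAlgebra.lift ℂ
        ((MulOpposite.opLinearEquiv ℂ).toLinearMap ∘ₗ rightAct X g)) f).unop p).1 = p.1 * f := by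
      induction f using TensorAlgebra.induction with
      | algebraMap r => intro p; simp [Algebra.smul_def, Algebra.commutes]
      | ι m => intro p; simp [rightAct]
      | mul a b ha hb => intro p; simp [ha, hb, mul_assoc]
      | add a b ha hb => intro p; simp [ha, hb, mul_add]
    simpa using h (1, d)
  have h : rightRec X d g (f * TensorAlgebra.ι ℂ m) =
      (((TensorAlgebra.lift ℂ ((MulOpposite.opLinearEquiv ℂ).toLinearMap ∘ₗ
        rightAct X g)) f).unop ((1 : Fock X), d)).1 * g m := by
    simp [rightRec, show ∀ p, rightAct X g m p = (p.1 * TensorAlgebra.ι ℂ m, p.1 * g m) from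
      fun _ => rfl]
  rw [h, key]

variable [DecidableEq ι]

/-- A vector of `X_i°` as a tensor of degree one. -/
noncomputable def letter (i : ι) : (X i).compl →ₗ[ℂ] Fock X :=
  (TensorAlgebra.ι ℂ) ∘ₗ DirectSum.lof ℂ ι (fun i => (X i).compl) i

/-- The elementary tensor `h₁ ⊗ ⋯ ⊗ hₙ` with `h_k ∈ X_{i_k}°`; it is the vacuum `1` for `n = 0`. -/
noncomputable def tensorWord (w : List (Σ i, (X i).compl)) : Fock X :=
  (w.map (fun p => letter X p.1 p.2)).prod

/-- The free product of the `(X_i, X_i°, ξ_i)`, that is,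
`ℂ ξ ⊕ ⨁_{n ≥ 1} ⨁_{i₁ ≠ i₂ ≠ ⋯ ≠ iₙ} X_{i₁}° ⊗ ⋯ ⊗ X_{iₙ}°`, where the state vector `ξ` is
the vacuum `1`. -/
noncomputable def freeProduct : Submodule ℂ (Fock X) :=
  Submodule.span ℂ
    {f | ∃ w : List (Σ i, (X i).compl), w.IsChain (fun p q => p.1 ≠ q.1) ∧ f = tensorWord X w}

/-- The embedding `X_i = ℂ ξ_i ⊕ X_i° → ℂ ξ ⊕ X_i°`, sending `ξ_i` to the vacuum. -/
noncomputable def embed (i : ι) : (X i).carrier →ₗ[ℂ] Fock X :=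
  (Algebra.linearMap ℂ (Fock X)) ∘ₗ (X i).ψ + letter X i ∘ₗ (X i).toCompl

/-- The action of `T ∈ L(X_i)` on the left-most tensor factor, before restriction to the free
product: with `v ⊗ f` standing for `embed v * f`, it sends the vacuum `ξ = ξ_i ⊗ ξ` to `T ξ_i ⊗ ξ`,
a tensor `h ⊗ f` with `h ∈ X_i°` to `T h ⊗ f`, and a tensor `m ⊗ f = ξ_i ⊗ (m ⊗ f)` with
`m ∈ X_j°`, `j ≠ i`, to `T ξ_i ⊗ (m ⊗ f)`. -/
noncomputable def leftFock (i : ι) (T : Module.End ℂ (X i).carrier) : Fock X →ₗ[ℂ] Fock X :=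
  leftRec X (embed X i (T (X i).ξ))
    (embed X i ∘ₗ T ∘ₗ (X i).compl.subtype ∘ₗ DirectSum.component ℂ ι _ i +
      LinearMap.mulLeft ℂ (embed X i (T (X i).ξ)) ∘ₗ TensorAlgebra.ι ℂ ∘ₗ
        (LinearMap.id - DirectSum.lof ℂ ι _ i ∘ₗ DirectSum.component ℂ ι _ i))

/-- The action of `T ∈ L(X_i)` on the right-most tensor factor, before restriction to the free
product; it is the mirror image of `leftFock`. -/
noncomputable def rightFock (i : ι) (T : Module.End ℂ (X i).carrier) : Fock X →ₗ[ℂ] Fock X :=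
  rightRec X (embed X i (T (X i).ξ))
    (embed X i ∘ₗ T ∘ₗ (X i).compl.subtype ∘ₗ DirectSum.component ℂ ι _ i +
      LinearMap.mulRight ℂ (embed X i (T (X i).ξ)) ∘ₗ TensorAlgebra.ι ℂ ∘ₗ
        (LinearMap.id - DirectSum.lof ℂ ι _ i ∘ₗ DirectSum.component ℂ ι _ i))

theorem leftFock_one (i : ι) (T : Module.End ℂ (X i).carrier) :
    leftFock X i T 1 = embed X i (T (X i).ξ) := leftRec_one X _ _

theorem leftFock_letter_same (i : ι) (T : Module.End ℂ (X i).carrier) (h : (X i).compl)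
    (f : Fock X) : leftFock X i T (letter X i h * f) = embed X i (T h) * f := by
  simp [leftFock, letter, leftRec_mul, DirectSum.component.lof_self]

theorem leftFock_letter_ne {i j : ι} (hij : j ≠ i) (T : Module.End ℂ (X i).carrier)
    (h : (X j).compl) (f : Fock X) :
    leftFock X i T (letter X j h * f) = embed X i (T (X i).ξ) * (letter X j h * f) := by
  simp [leftFock, letter, leftRec_mul, DirectSum.component.of, hij, mul_assoc]

theorem rightFock_one (i : ι) (T : Module.End ℂ (X i).carrier) :
    rightFock X i T 1 = embed X i (T (X i).ξ) := rightRec_one X _ _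

theorem rightFock_letter_same (i : ι) (T : Module.End ℂ (X i).carrier) (h : (X i).compl)
    (f : Fock X) : rightFock X i T (f * letter X i h) = f * embed X i (T h) := by
  simp [rightFock, letter, rightRec_mul, DirectSum.component.lof_self]

theorem rightFock_letter_ne {i j : ι} (hij : j ≠ i) (T : Module.End ℂ (X i).carrier)
    (h : (X j).compl) (f : Fock X) :
    rightFock X i T (f * letter X j h) = f * letter X j h * embed X i (T (X i).ξ) := by
  simp [rightFock, letter, rightRec_mul, DirectSum.component.of, hij, mul_assoc]

theorem tensorWord_mem {w : List (Σ i, (X i).compl)} (hw : w.IsChain (fun p q => p.1 ≠ q.1)) :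
    tensorWord X w ∈ freeProduct X := Submodule.subset_span ⟨w, hw, rfl⟩

theorem embed_mul_mem (i : ι) (v : (X i).carrier) {w : List (Σ i, (X i).compl)}
    (hw : w.IsChain (fun p q => p.1 ≠ q.1)) (hi : ∀ p ∈ w.head?, p.1 ≠ i) :
    embed X i v * tensorWord X w ∈ freeProduct X := by
  have h1 : embed X i v * tensorWord X w =
      (X i).ψ v • tensorWord X w + tensorWord X (⟨i, (X i).toCompl v⟩ :: w) := by
    simp [embed, tensorWord, add_mul, Algebra.smul_def]
  rw [h1]
  refine add_mem (Submodule.smul_mem _ _ (tensorWord_mem X hw)) (tensorWord_mem X ?_)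
  rw [List.isChain_cons]
  exact ⟨fun p hp => (hi p hp).symm, hw⟩

theorem mul_embed_mem (i : ι) (v : (X i).carrier) {w : List (Σ i, (X i).compl)}
    (hw : w.IsChain (fun p q => p.1 ≠ q.1)) (hi : ∀ p ∈ w.getLast?, p.1 ≠ i) :
    tensorWord X w * embed X i v ∈ freeProduct X := by
  have h1 : tensorWord X w * embed X i v =
      (X i).ψ v • tensorWord X w + tensorWord X (w ++ [⟨i, (X i).toCompl v⟩]) := by
    simp [embed, tensorWord, mul_add, Algebra.smul_def, Algebra.commutes]
  rw [h1]
  refine add_mem (Submodule.smul_mem _ _ (tensorWord_mem X hw)) (tensorWord_mem X ?_)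
  rw [List.isChain_append]
  refine ⟨hw, List.isChain_singleton _, fun p hp q hq => ?_⟩
  simp only [List.head?_cons, Option.mem_def, Option.some.injEq] at hq
  subst hq
  exact hi p hp

theorem leftFock_mem (i : ι) (T : Module.End ℂ (X i).carrier) :
    ∀ f ∈ freeProduct X, leftFock X i T f ∈ freeProduct X := by
  intro f hf
  refine Submodule.span_induction (p := fun f _ => leftFock X i T f ∈ freeProduct X)
    ?_ (by simp) (fun a b _ _ ha hb => by simpa using add_mem ha hb)
    (fun c a _ ha => by simpa using Submodule.smul_mem _ c ha) hf
  rintro _ ⟨w, hw, rfl⟩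
  cases w with
  | nil =>
    have h := embed_mul_mem X i (T (X i).ξ) (w := []) List.isChain_nil (by simp)
    simpa [tensorWord, leftFock_one] using h
  | cons p w =>
    obtain ⟨j, h⟩ := p
    have hw' := List.isChain_cons.1 hw
    have hs : tensorWord X (⟨j, h⟩ :: w) = letter X j h * tensorWord X w := by simp [tensorWord]
    by_cases hij : j = i
    · subst hij
      rw [hs, leftFock_letter_same]
      exact embed_mul_mem X j _ hw'.2 (fun p hp => (hw'.1 p hp).symm)
    · rw [hs, leftFock_letter_ne X hij, ← hs]
      exact embed_mul_mem X i _ hw (by simpa using hij)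

theorem rightFock_mem (i : ι) (T : Module.End ℂ (X i).carrier) :
    ∀ f ∈ freeProduct X, rightFock X i T f ∈ freeProduct X := by
  intro f hf
  refine Submodule.span_induction (p := fun f _ => rightFock X i T f ∈ freeProduct X)
    ?_ (by simp) (fun a b _ _ ha hb => by simpa using add_mem ha hb)
    (fun c a _ ha => by simpa using Submodule.smul_mem _ c ha) hf
  rintro _ ⟨w, hw, rfl⟩
  rcases List.eq_nil_or_concat w with rfl | ⟨w, p, rfl⟩
  · have h := mul_embed_mem X i (T (X i).ξ) (w := []) List.isChain_nil (by simp)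
    simpa [tensorWord, rightFock_one] using h
  · obtain ⟨j, h⟩ := p
    rw [List.concat_eq_append] at hw ⊢
    have hw' := List.isChain_append.1 hw
    have hs : tensorWord X (w ++ [⟨j, h⟩]) = tensorWord X w * letter X j h := by simp [tensorWord]
    by_cases hij : j = i
    · subst hij
      rw [hs, rightFock_letter_same]
      exact mul_embed_mem X j _ hw'.1 (fun p hp => hw'.2.2 p hp ⟨j, h⟩ (by simp))
    · rw [hs, rightFock_letter_ne X hij, ← hs]
      exact mul_embed_mem X i _ hw (by simpa using hij)

/-- The left representation `λ_i : L(X_i) → L(X)` on the free product `X`. -/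
noncomputable def leftOp (i : ι) (T : Module.End ℂ (X i).carrier) :
    Module.End ℂ (freeProduct X) :=
  (leftFock X i T).restrict (leftFock_mem X i T)

/-- The right representation `ρ_i : L(X_i) → L(X)` on the free product `X`. -/
noncomputable def rightOp (i : ι) (T : Module.End ℂ (X i).carrier) :
    Module.End ℂ (freeProduct X) :=
  (rightFock X i T).restrict (rightFock_mem X i T)

/-- The state vector `ξ` of the free product. -/
noncomputable def vacuum : freeProduct X := ⟨1, tensorWord_mem X List.isChain_nil⟩

/-- The functional on the free product that gives the coefficient of the state vector `ξ`; it
vanishes on all tensors of positive degree. -/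
noncomputable def vacuumCoeff : freeProduct X →ₗ[ℂ] ℂ :=
  TensorAlgebra.algebraMapInv.toLinearMap ∘ₗ (freeProduct X).subtype

end FreeProduct

end StateSpace

/-! ### Bi-freeness -/

open StateSpace in
/-- Voiculescu's bi-freeness of a family `(B_k, C_k)` of pairs of faces (unital subalgebras of
`A`): there are vector spaces with specified state vectors `X_k` and unital representations of `B_k`
and `C_k` on `X_k` such that the joint distribution of all the `B_k`, `C_k` with respect to `φ` is
that of the operators `λ_k(l_k(b))`, `ρ_k(r_k(c))` on the free product of the `X_k`, with respect to
the vacuum. (The distribution is the collection of all the mixed moments; the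
universe of the `X_k` is that of `A`, which is enough, since one may always take for `X_k` the free
product of algebras `B_k * C_k` with its canonical functional.) -/
def IsBiFree {A : Type u} [Ring A] [Algebra ℂ A] (φ : A →ₗ[ℂ] ℂ) {ι : Type*} [DecidableEq ι]
    (B C : ι → Subalgebra ℂ A) : Prop :=
  ∃ (X : ι → StateSpace.{u})
    (l : ∀ k, B k →ₐ[ℂ] Module.End ℂ (X k).carrier)
    (r : ∀ k, C k →ₐ[ℂ] Module.End ℂ (X k).carrier),
    ∀ w : List (Σ k, (B k ⊕ C k)),
      φ (w.map (fun p => (match p with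
        | ⟨_, Sum.inl b⟩ => (b : A)
        | ⟨_, Sum.inr c⟩ => (c : A) : A))).prod =
      vacuumCoeff X ((w.map (fun p => (match p with
        | ⟨k, Sum.inl b⟩ => leftOp X k (l k b)
        | ⟨k, Sum.inr c⟩ => rightOp X k (r k c) : Module.End ℂ (freeProduct X)))).prod
          (vacuum X))

/-- Bi-freeness of two pairs `(b₁, c₁)`, `(b₂, c₂)` of random variables: bi-freeness of the pairs of
faces formed by the unital algebras that the left and the right variables generate. -/
def AreBiFreePairs {A : Type u} [Ring A] [Algebra ℂ A] (φ : A →ₗ[ℂ] ℂ) (p q : A × A) : Prop :=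
  IsBiFree φ (fun k : Fin 2 => Algebra.adjoin ℂ {(![p, q] k).1})
    (fun k : Fin 2 => Algebra.adjoin ℂ {(![p, q] k).2})

/-! On the free `*`-algebra on `x` and `y`, let `φ` be `1` on the words whose `y`-exponents are, in
order of appearance, the opposites of their `x`-exponents, and `0` on all other words. In a
bi-non-crossing partition into pairs consisting of a left and a right position, the `k`-th left
position must be paired with the `k`-th right one. Hence the words with `φ = 1` are exactly those
with such a partition into pairs of opposite exponents, the partition is then unique, and the
moment-cumulant formula shows that the cumulants are `1` on such pairs and `0` otherwise.

Bi-freeness of `(xx*, yy*)` and `(x*x, y*y)` would give `φ(xx* · y*y) = φ(xx*) φ(y*y)`, but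
`φ(xx* · y*y) = 1`, while `φ(xx*) = 0`. -/

section StarMonoidAlgebra

variable {R M : Type*} [Semiring R] [StarRing R] [Monoid M] [StarMul M]

/-- The involution `∑ rₘ m ↦ ∑ rₘ* m*` of the monoid algebra of a monoid with involution, as an
isomorphism onto the opposite ring. -/
noncomputable def monoidAlgebraStar : MonoidAlgebra R M ≃+* (MonoidAlgebra R M)ᵐᵒᵖ :=
  ((MonoidAlgebra.mapRingEquiv M starRingEquiv).trans
    (MonoidAlgebra.mapDomainRingEquiv Rᵐᵒᵖ starMulEquiv)).trans MonoidAlgebra.opRingEquiv.symm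

theorem monoidAlgebraStar_single (m : M) (r : R) :
    monoidAlgebraStar (MonoidAlgebra.single m r) =
      MulOpposite.op (MonoidAlgebra.single (star m) (star r)) := by
  simp [monoidAlgebraStar]

noncomputable instance : StarRing (MonoidAlgebra R M) where
  star f := (monoidAlgebraStar f).unop
  star_involutive f := by
    induction f using MonoidAlgebra.induction_linear with
    | zero => simp
    | add f g hf hg => simp only [map_add, MulOpposite.unop_add, hf, hg]
    | single m r => simp [monoidAlgebraStar_single]
  star_add f g := by simp only [map_add, MulOpposite.unop_add]
  star_mul f g := by simp only [map_mul, MulOpposite.unop_mul]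

theorem star_monoidAlgebra_single (m : M) (r : R) :
    star (MonoidAlgebra.single m r) = MonoidAlgebra.single (star m) (star r) :=
  congrArg MulOpposite.unop (monoidAlgebraStar_single m r)

instance {R : Type*} [CommSemiring R] [StarRing R] : StarModule R (MonoidAlgebra R M) where
  star_smul r f := by
    induction f using MonoidAlgebra.induction_linear with
    | zero => simp
    | add f g hf hg => rw [smul_add, star_add, star_add, hf, hg, smul_add]
    | single m s => simp [star_monoidAlgebra_single]

theorem monoidAlgebra_constr_single {R M E : Type*} [CommSemiring R] [AddCommMonoid E] [Module R E]
    (f : M → E) (m : M) (r : R) :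
    (MonoidAlgebra.basis M R).constr R f (MonoidAlgebra.single m r) = r • f m := by
  rw [← mul_one r, ← smul_eq_mul, ← MonoidAlgebra.smul_single, ← MonoidAlgebra.basis_apply,
    map_smul, Module.Basis.constr_basis, smul_eq_mul, mul_one]

theorem isStarProbability_constr {f : M → ℂ} (map_one : f 1 = 1)
    (map_star : ∀ m, f (star m) = star (f m)) :
    IsStarProbability ((MonoidAlgebra.basis M ℂ).constr ℂ f) where
  map_one := by rw [MonoidAlgebra.one_def, monoidAlgebra_constr_single, map_one, one_smul]
  map_star a := by
    induction a using MonoidAlgebra.induction_linear with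
    | zero => simp
    | add a b ha hb => rw [star_add, map_add, map_add, ha, hb, star_add]
    | single m c =>
      rw [star_monoidAlgebra_single, monoidAlgebra_constr_single, monoidAlgebra_constr_single,
        map_star, star_smul]

end StarMonoidAlgebra

/-- The free monoid with involution on `α`: words in the letters `a` and `a*` for `a : α`, where
the letter `a` is encoded by `(a, false)` and `a*` by `(a, true)`. It is a type of its own because
the involution of `FreeMonoid` only reverses words. -/
def FreeStarMonoid (α : Type*) : Type _ := FreeMonoid (α × Bool)

namespace FreeStarMonoid

variable {α : Type*}

instance : Monoid (FreeStarMonoid α) := inferInstanceAs (Monoid (FreeMonoid (α × Bool)))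

/-- The word of length one with the letter `a` if `e = false`, and `a*` if `e = true`. -/
def letter (a : α) (e : Bool) : FreeStarMonoid α := FreeMonoid.of (a, e)

/-- The letters of a word. -/
def toList (w : FreeStarMonoid α) : List (α × Bool) := FreeMonoid.toList w

@[simp] theorem toList_one : (1 : FreeStarMonoid α).toList = [] := rfl

@[simp] theorem toList_mul (v w : FreeStarMonoid α) : (v * w).toList = v.toList ++ w.toList := rfl

@[simp] theorem toList_letter (a : α) (e : Bool) : (letter a e).toList = [(a, e)] := rfl

@[ext] theorem ext {v w : FreeStarMonoid α} (h : v.toList = w.toList) : v = w := h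

instance : Star (FreeStarMonoid α) where
  star w := FreeMonoid.ofList (w.toList.map (Prod.map id not)).reverse

@[simp] theorem toList_star (w : FreeStarMonoid α) :
    (star w).toList = (w.toList.map (Prod.map id not)).reverse := rfl

instance : StarMul (FreeStarMonoid α) where
  star_involutive w := by ext1; simp [Function.comp_def, Prod.map]
  star_mul v w := by ext1; simp

theorem star_letter (a : α) (e : Bool) : star (letter a e) = letter a !e := rfl

/-- The element `a` (if `e = false`) or `a*` (if `e = true`) of the free `*`-algebra on `α`. -/
noncomputable def generator (a : α) (e : Bool) : MonoidAlgebra ℂ (FreeStarMonoid α) :=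
  MonoidAlgebra.of ℂ _ (letter a e)

theorem star_generator (a : α) (e : Bool) : star (generator a e) = generator a !e := by
  simp [generator, star_monoidAlgebra_single, star_letter]

theorem orderedProd_generator {n : ℕ} (χ : Fin n → α) (ω : Fin n → Bool) (V : Finset (Fin n)) :
    orderedProd (fun k => generator (χ k) (ω k)) V =
      MonoidAlgebra.single (V.sort.map fun k => letter (χ k) (ω k)).prod 1 := by
  rw [← MonoidAlgebra.of_apply, map_list_prod, List.map_map]
  rfl

variable [DecidableEq α]

/-- The exponents of the occurrences of `a` and `a*` in a word, in order of appearance. -/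
def exponents (a : α) (w : FreeStarMonoid α) : List Bool :=
  (w.toList.filter (·.1 = a)).map Prod.snd

theorem exponents_star (a : α) (w : FreeStarMonoid α) :
    exponents a (star w) = ((exponents a w).map not).reverse := by
  simp [exponents, List.filter_map, Function.comp_def]

theorem exponents_prod_letter {ι : Type*} (a : α) (χ : ι → α) (ω : ι → Bool) (L : List ι) :
    exponents a (L.map fun k => letter (χ k) (ω k)).prod = (L.filter (χ · = a)).map ω := by
  have toList_prod : (L.map fun k => letter (χ k) (ω k)).prod.toList =
      L.map fun k => (χ k, ω k) := by
    induction L with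
    | nil => rfl
    | cons k L ih => simp [ih]
  simp [exponents, toList_prod, List.filter_map, Function.comp_def]

end FreeStarMonoid

instance : DecidableEq Side
  | .l, .l | .r, .r => isTrue rfl
  | .l, .r | .r, .l => isFalse Side.noConfusion

/-- A word in `x, x*` and `y, y*` is balanced if its `y`-exponents are, in order of appearance,
the opposites of its `x`-exponents. -/
def IsBalanced (w : FreeStarMonoid Side) : Prop :=
  w.exponents .r = (w.exponents .l).map not

theorem isBalanced_star (w : FreeStarMonoid Side) : IsBalanced (star w) ↔ IsBalanced w := by
  simp only [IsBalanced, FreeStarMonoid.exponents_star, List.map_reverse, List.reverse_inj]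
  exact (List.map_injective_iff.2 Bool.not_injective).eq_iff

open Classical in
/-- The functional on the free `*`-algebra on `x, y` (that is, on `Side.l, Side.r`) whose value is
`1` at the balanced words and `0` at all other words. -/
noncomputable def balancedState : MonoidAlgebra ℂ (FreeStarMonoid Side) →ₗ[ℂ] ℂ :=
  (MonoidAlgebra.basis _ ℂ).constr ℂ fun w => if IsBalanced w then 1 else 0

open Classical in
theorem balancedState_single (w : FreeStarMonoid Side) :
    balancedState (MonoidAlgebra.single w 1) = if IsBalanced w then 1 else 0 := by
  rw [balancedState, monoidAlgebra_constr_single, one_smul]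

theorem isStarProbability_balancedState : IsStarProbability balancedState :=
  isStarProbability_constr (if_pos rfl) fun w => by
    classical
    rw [apply_ite star, star_one, star_zero]
    exact if_congr (isBalanced_star w) rfl rfl

theorem starLetter_generator (s : Side) (e : Bool) :
    starLetter (FreeStarMonoid.generator .l false) (FreeStarMonoid.generator .r false) s e =
      FreeStarMonoid.generator s e := by
  cases s <;> cases e <;> simp [starLetter, FreeStarMonoid.star_generator]

section Cumulants

variable {n : ℕ} {χ : Fin n → Side}

theorem self_mem_parts_iff {α : Type*} [DecidableEq α] {V : Finset α} (hV : V ≠ ∅)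
    (π : Finpartition V) : V ∈ π.parts ↔ π = Finpartition.indiscrete hV := by
  constructor
  · intro hπ
    refine Finpartition.ext (Finset.eq_singleton_iff_unique_mem.2 ⟨hπ, fun W hW => ?_⟩)
    obtain ⟨i, hi⟩ := π.nonempty_of_mem_parts hW
    exact π.eq_of_mem_parts hW hπ hi (π.subset hW hi)
  · rintro rfl
    exact Finset.mem_singleton_self V

theorem isBiNonCrossing_indiscrete {V : Finset (Fin n)} (hV : V ≠ ∅) :
    IsBiNonCrossing χ (Finpartition.indiscrete hV) := by
  intro P hP Q hQ _ _ _ _ _ _ _ _ _ _ _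
  rw [Finset.mem_singleton.1 hP, Finset.mem_singleton.1 hQ]

open Classical in
theorem sum_prod_parts_of_self_mem {κ : Finset (Fin n) → ℂ} (map_empty : κ ∅ = 0)
    (V : Finset (Fin n)) :
    ∑ π : Finpartition V with IsBiNonCrossing χ π ∧ V ∈ π.parts, ∏ W ∈ π.parts, κ W = κ V := by
  rcases eq_or_ne V ∅ with rfl | hV
  · rw [map_empty, Finset.sum_eq_zero]
    exact fun π hπ => absurd (Finset.mem_filter.1 hπ).2.2 π.bot_notMem
  · simp only [self_mem_parts_iff hV]
    rw [Finset.sum_eq_single_of_mem (Finpartition.indiscrete hV)]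
    · exact Finset.prod_singleton κ V
    · exact Finset.mem_filter.2 ⟨Finset.mem_univ _, isBiNonCrossing_indiscrete hV, rfl⟩
    · exact fun π hπ hne => absurd (Finset.mem_filter.1 hπ).2.2 hne

open Classical in
theorem biFreeCumulantOn_eq_of_moment_eq {A : Type*} [Ring A] [Algebra ℂ A] {φ : A →ₗ[ℂ] ℂ}
    {a : Fin n → A} {κ : Finset (Fin n) → ℂ} (map_empty : κ ∅ = 0)
    (moment_eq : ∀ V, φ (orderedProd a V) =
      ∑ π : Finpartition V with IsBiNonCrossing χ π, ∏ W ∈ π.parts, κ W)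
    (V : Finset (Fin n)) : biFreeCumulantOn φ χ a V = κ V := by
  induction V using Finset.strongInduction with
  | H V ih =>
  have proper_sum :
      ∑ π : {π : Finpartition V // IsBiNonCrossing χ π ∧ V ∉ π.parts},
        ∏ W : {W // W ∈ π.1.parts}, biFreeCumulantOn φ χ a W.1 =
      ∑ π : Finpartition V with IsBiNonCrossing χ π ∧ V ∉ π.parts, ∏ W ∈ π.parts, κ W := by
    rw [Finset.sum_subtype (p := fun π => IsBiNonCrossing χ π ∧ V ∉ π.parts) _ (by simp)]
    refine Finset.sum_congr rfl fun π _ => ?_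
    rw [Finset.prod_subtype (p := (· ∈ π.1.parts)) _ fun _ => Iff.rfl]
    refine Finset.prod_congr rfl fun W _ => ih W ?_
    exact (π.1.le W.2).lt_of_ne (ne_of_mem_of_not_mem W.2 π.2.2)
  rw [biFreeCumulantOn, proper_sum, moment_eq, ← sum_prod_parts_of_self_mem (χ := χ) map_empty V,
    sub_eq_iff_eq_add, ← Finset.filter_filter, ← Finset.filter_filter,
    Finset.sum_filter_add_sum_filter_not]

end Cumulants

section FinsetSort

variable {α β : Type*} [LinearOrder α] [LinearOrder β] {s : Finset α} {f g : α → β}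

theorem filter_sort (s : Finset α) (p : α → Prop) [DecidablePred p] :
    s.sort.filter p = (s.filter p).sort := by
  refine List.SortedLT.eq_of_mem_iff ?_ (s.filter p).sortedLT_sort (by simp)
  exact (s.sortedLT_sort.pairwise.filter _).sortedLT

theorem map_sort_of_strictMonoOn (hf : StrictMonoOn f s) : s.sort.map f = (s.image f).sort := by
  refine List.SortedLT.eq_of_mem_iff ?_ (s.image f).sortedLT_sort (by simp)
  refine (List.pairwise_map.2 (s.sortedLT_sort.pairwise.imp_of_mem fun ha hb hab => ?_)).sortedLT
  exact hf ((Finset.mem_sort _).1 ha) ((Finset.mem_sort _).1 hb) hab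

theorem eqOn_of_strictMonoOn_of_image_eq (hf : StrictMonoOn f s) (hg : StrictMonoOn g s)
    (himage : s.image f = s.image g) : Set.EqOn f g s := fun i hi =>
  List.map_inj_left.1 (by rw [map_sort_of_strictMonoOn hf, map_sort_of_strictMonoOn hg, himage]) i
    ((Finset.mem_sort _).2 hi)

theorem exists_strictMonoOn_image_eq {s t : Finset α} (hcard : s.card = t.card) :
    ∃ f : α → α, StrictMonoOn f s ∧ s.image f = t := by
  let e : s ≃o t := (s.orderIsoOfFin rfl).symm.trans (t.orderIsoOfFin hcard.symm)
  have extend_coe : ∀ i : s, Function.extend Subtype.val (fun i => (e i : α)) id i = e i :=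
    fun i => Subtype.val_injective.extend_apply _ _ i
  refine ⟨Function.extend Subtype.val (fun i => (e i : α)) id, fun i hi j hj hij => ?_, ?_⟩
  · rw [extend_coe ⟨i, hi⟩, extend_coe ⟨j, hj⟩]
    exact e.strictMono hij
  · ext j
    rw [Finset.mem_image]
    constructor
    · rintro ⟨i, hi, rfl⟩
      rw [extend_coe ⟨i, hi⟩]
      exact (e ⟨i, hi⟩).2
    · intro hj
      exact ⟨e.symm ⟨j, hj⟩, (e.symm ⟨j, hj⟩).2, by rw [extend_coe, e.apply_symm_apply]⟩

end FinsetSort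

section Pairings

variable {n : ℕ} (χ : Fin n → Side) (ω : Fin n → Bool)

/-- The positions of `V` on the side `s`. -/
def sidePositions (s : Side) (V : Finset (Fin n)) : Finset (Fin n) :=
  V.filter (χ · = s)

/-- The exponents at the positions of `V` on the side `s`, read in increasing order. -/
def sideWord (s : Side) (V : Finset (Fin n)) : List Bool :=
  (sidePositions χ s V).sort.map ω

/-- The exponents at the right positions of `V` are, in order, the opposites of those at the left
positions. -/
def HasOppositeWords (V : Finset (Fin n)) : Prop :=
  sideWord χ ω .r V = (sideWord χ ω .l V).map not

/-- `W` consists of a left and a right position that carry different exponents. -/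
def IsOppositePair (W : Finset (Fin n)) : Prop :=
  ∃ i j, W = {i, j} ∧ χ i = .l ∧ χ j = .r ∧ ω j = !ω i

/-- A bi-non-crossing partition into opposite pairs. -/
structure IsOppositePairing {V : Finset (Fin n)} (π : Finpartition V) : Prop where
  isBiNonCrossing : IsBiNonCrossing χ π
  isOppositePair : ∀ W ∈ π.parts, IsOppositePair χ ω W

/-- `f` restricts to an increasing bijection from the left to the right positions of `V` that
reverses exponents. The values of `f` outside the left positions of `V` are irrelevant. -/
structure IsOppositeMatching (V : Finset (Fin n)) (f : Fin n → Fin n) : Prop where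
  strictMonoOn : StrictMonoOn f (sidePositions χ .l V)
  image_eq : (sidePositions χ .l V).image f = sidePositions χ .r V
  exponent_eq : ∀ i ∈ sidePositions χ .l V, ω (f i) = !ω i

variable {χ ω} {V : Finset (Fin n)}

theorem mem_sidePositions {s : Side} {i : Fin n} : i ∈ sidePositions χ s V ↔ i ∈ V ∧ χ i = s :=
  Finset.mem_filter

theorem sideWord_right_eq_map {f : Fin n → Fin n}
    (hf : StrictMonoOn f (sidePositions χ .l V))
    (himage : (sidePositions χ .l V).image f = sidePositions χ .r V) :
    sideWord χ ω .r V = (sidePositions χ .l V).sort.map (ω ∘ f) := by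
  rw [sideWord, ← himage, ← map_sort_of_strictMonoOn hf, List.map_map]

theorem hasOppositeWords_iff_exists_isOppositeMatching :
    HasOppositeWords χ ω V ↔ ∃ f, IsOppositeMatching χ ω V f := by
  constructor
  · intro h
    have hcard : (sidePositions χ .l V).card = (sidePositions χ .r V).card := by
      simpa [HasOppositeWords, sideWord] using (congrArg List.length h).symm
    obtain ⟨f, hf, himage⟩ := exists_strictMonoOn_image_eq hcard
    rw [HasOppositeWords, sideWord_right_eq_map hf himage, sideWord, List.map_map,
      List.map_inj_left] at h
    exact ⟨f, hf, himage, fun i hi => h i ((Finset.mem_sort _).2 hi)⟩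
  · rintro ⟨f, hf, himage, hω⟩
    rw [HasOppositeWords, sideWord_right_eq_map hf himage, sideWord, List.map_map]
    exact List.map_congr_left fun i hi => hω i ((Finset.mem_sort _).1 hi)

theorem eq_of_pair_eq_pair {i i' j j' : Fin n} (hi : χ i = .l) (hi' : χ i' = .l)
    (hj : χ j = .r) (hj' : χ j' = .r) (h : ({i, j} : Finset (Fin n)) = {i', j'}) :
    i = i' ∧ j = j' := by
  have hmem : ∀ k, k = i ∨ k = j ↔ k = i' ∨ k = j' := fun k => by
    simpa using congrArg (k ∈ ·) h
  have hil := hmem i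
  have hjr := hmem j
  grind

theorem IsBiNonCrossing.lt_of_pairs_mem_parts {π : Finpartition V} (hπ : IsBiNonCrossing χ π)
    {i i' j j' : Fin n} (hi : χ i = .l) (hi' : χ i' = .l) (hj : χ j = .r) (hj' : χ j' = .r)
    (hP : {i, j} ∈ π.parts) (hQ : {i', j'} ∈ π.parts) (hlt : i < i') : j < j' := by
  have blocks_ne : ({i, j} : Finset (Fin n)) ≠ {i', j'} := fun h =>
    hlt.ne (eq_of_pair_eq_pair hi hi' hj hj' h).1
  rcases lt_trichotomy j j' with h | rfl | h
  · exact h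
  · exact absurd (π.eq_of_mem_parts hP hQ (a := j) (by simp) (by simp)) blocks_ne
  · -- the blocks cross, as `i ≺ i' ≺ j ≺ j'`
    refine absurd (hπ _ hP _ hQ i (by simp) i' (by simp) j (by simp) j' (by simp) ?_ ?_ ?_)
      blocks_ne
    all_goals simp [chiLT, hi, hi', hj, hj', hlt, h]

namespace IsOppositePairing

variable {π : Finpartition V} {f : Fin n → Fin n}

theorem exists_right_partner (hπ : IsOppositePairing χ ω π) {i : Fin n} (hiV : i ∈ V)
    (hi : χ i = .l) : ∃ j, {i, j} ∈ π.parts ∧ χ j = .r ∧ ω j = !ω i := by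
  obtain ⟨W, hW, hiW⟩ := π.exists_mem hiV
  obtain ⟨i', j, rfl, -, hj, hω⟩ := hπ.isOppositePair W hW
  obtain rfl : i = i' := by grind
  exact ⟨j, hW, hj, hω⟩

theorem exists_left_partner (hπ : IsOppositePairing χ ω π) {j : Fin n} (hjV : j ∈ V)
    (hj : χ j = .r) : ∃ i, {i, j} ∈ π.parts ∧ χ i = .l := by
  obtain ⟨W, hW, hjW⟩ := π.exists_mem hjV
  obtain ⟨i, j', rfl, hi, -, -⟩ := hπ.isOppositePair W hW
  obtain rfl : j = j' := by grind
  exact ⟨i, hW, hi⟩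

theorem parts_eq_image (hπ : IsOppositePairing χ ω π)
    (hf : ∀ i ∈ sidePositions χ .l V, {i, f i} ∈ π.parts) :
    π.parts = (sidePositions χ .l V).image fun i => {i, f i} := by
  refine (Finset.image_subset_iff.2 hf).antisymm' fun W hW => ?_
  obtain ⟨i, j, rfl, hi, -, -⟩ := hπ.isOppositePair W hW
  have hiL : i ∈ sidePositions χ .l V :=
    mem_sidePositions.2 ⟨π.subset hW (Finset.mem_insert_self _ _), hi⟩
  exact Finset.mem_image.2 ⟨i, hiL, π.eq_of_mem_parts (hf i hiL) hW
    (Finset.mem_insert_self _ _) (Finset.mem_insert_self _ _)⟩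

theorem exists_isOppositeMatching (hπ : IsOppositePairing χ ω π) :
    ∃ f, IsOppositeMatching χ ω V f ∧
      π.parts = (sidePositions χ .l V).image fun i => {i, f i} := by
  have partner : ∀ i ∈ sidePositions χ .l V, ∃ j,
      {i, j} ∈ π.parts ∧ χ j = .r ∧ ω j = !ω i := fun i hi =>
    hπ.exists_right_partner (mem_sidePositions.1 hi).1 (mem_sidePositions.1 hi).2
  choose! f mem_parts right exponent_eq using partner
  have left : ∀ i ∈ sidePositions χ .l V, χ i = .l := fun i hi => (mem_sidePositions.1 hi).2
  refine ⟨f, ⟨fun i hi i' hi' hlt => ?_, ?_, exponent_eq⟩, hπ.parts_eq_image mem_parts⟩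
  · exact hπ.isBiNonCrossing.lt_of_pairs_mem_parts (left i hi) (left i' hi') (right i hi)
      (right i' hi') (mem_parts i hi) (mem_parts i' hi') hlt
  · ext j
    rw [Finset.mem_image, mem_sidePositions]
    constructor
    · rintro ⟨i, hi, rfl⟩
      exact ⟨π.subset (mem_parts i hi) (by simp), right i hi⟩
    · rintro ⟨hjV, hj⟩
      obtain ⟨i, hij, hil⟩ := hπ.exists_left_partner hjV hj
      have hi : i ∈ sidePositions χ .l V := mem_sidePositions.2 ⟨π.subset hij (by simp), hil⟩
      have blocks_eq := π.eq_of_mem_parts (mem_parts i hi) hij (a := i) (by simp) (by simp)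
      exact ⟨i, hi, (eq_of_pair_eq_pair hil hil (right i hi) hj blocks_eq).2⟩

protected theorem unique {π' : Finpartition V} (hπ : IsOppositePairing χ ω π)
    (hπ' : IsOppositePairing χ ω π') : π = π' := by
  obtain ⟨f, hf, hparts⟩ := hπ.exists_isOppositeMatching
  obtain ⟨f', hf', hparts'⟩ := hπ'.exists_isOppositeMatching
  have hff' := eqOn_of_strictMonoOn_of_image_eq hf.strictMonoOn hf'.strictMonoOn
    (hf.image_eq.trans hf'.image_eq.symm)
  refine Finpartition.ext ?_
  rw [hparts, hparts']
  exact Finset.image_congr fun i hi => by rw [hff' hi]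

end IsOppositePairing

namespace IsOppositeMatching

variable {f : Fin n → Fin n}

theorem right_mem (hf : IsOppositeMatching χ ω V f) {i : Fin n} (hi : i ∈ sidePositions χ .l V) :
    f i ∈ sidePositions χ .r V :=
  hf.image_eq ▸ Finset.mem_image_of_mem f hi

theorem disjoint_blocks (hf : IsOppositeMatching χ ω V f) :
    (sidePositions χ .l V : Set (Fin n)).PairwiseDisjoint fun i => ({i, f i} : Finset (Fin n)) := by
  intro i hi i' hi' hne
  have hfi := mem_sidePositions.1 (hf.right_mem hi)
  have hfi' := mem_sidePositions.1 (hf.right_mem hi')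
  have hff' := hf.strictMonoOn.injOn.ne hi hi' hne
  rw [Finset.mem_coe, mem_sidePositions] at hi hi'
  simp only [Function.onFun, Finset.disjoint_left, Finset.mem_insert, Finset.mem_singleton]
  grind

theorem sup_blocks (hf : IsOppositeMatching χ ω V f) :
    ((sidePositions χ .l V).image fun i => ({i, f i} : Finset (Fin n))).sup id = V := by
  ext k
  have image_eq := hf.image_eq
  simp only [Finset.ext_iff, Finset.mem_image, mem_sidePositions] at image_eq
  simp only [Finset.mem_sup, Finset.mem_image, mem_sidePositions, id]
  constructor
  · grind
  · intro hk
    cases hs : χ k with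
    | l => exact ⟨_, ⟨k, ⟨hk, hs⟩, rfl⟩, by simp⟩
    | r =>
      obtain ⟨i, hi, rfl⟩ := (image_eq k).2 ⟨hk, hs⟩
      exact ⟨_, ⟨i, hi, rfl⟩, by simp⟩

/-- The partition of `V` into the blocks `{i, f i}`, for `i` a left position of `V`. -/
def toFinpartition (hf : IsOppositeMatching χ ω V f) : Finpartition V where
  parts := (sidePositions χ .l V).image fun i => {i, f i}
  supIndep := (Finset.supIndep_iff_pairwiseDisjoint.2 hf.disjoint_blocks).image
  sup_parts := hf.sup_blocks
  bot_notMem h := by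
    obtain ⟨i, -, hi⟩ := Finset.mem_image.1 h
    exact Finset.insert_ne_empty _ _ hi

theorem isOppositePairing_toFinpartition (hf : IsOppositeMatching χ ω V f) :
    IsOppositePairing χ ω hf.toFinpartition where
  isBiNonCrossing P hP Q hQ a ha b hb c hc d hd hab hbc hcd := by
    obtain ⟨i, hi, rfl⟩ := Finset.mem_image.1 hP
    obtain ⟨j, hj, rfl⟩ := Finset.mem_image.1 hQ
    have hil := (mem_sidePositions.1 hi).2
    have hjl := (mem_sidePositions.1 hj).2
    have hir := (mem_sidePositions.1 (hf.right_mem hi)).2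
    have hjr := (mem_sidePositions.1 (hf.right_mem hj)).2
    have hij := hf.strictMonoOn hi hj
    simp only [Finset.mem_insert, Finset.mem_singleton] at ha hb hc hd
    exfalso
    -- the blocks are nested: `i ≺ j` means `i < j`, hence `f i < f j`, that is, `f j ≺ f i`
    rcases ha with rfl | rfl <;> rcases hb with rfl | rfl <;> rcases hc with rfl | rfl <;>
      rcases hd with rfl | rfl <;> simp only [chiLT, hil, hjl, hir, hjr] at hab hbc hcd <;>
      first | exact lt_asymm hab hbc | exact lt_asymm hbc hcd | exact lt_asymm hcd (hij hab)
  isOppositePair W hW := by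
    obtain ⟨i, hi, rfl⟩ := Finset.mem_image.1 hW
    exact ⟨i, f i, rfl, (mem_sidePositions.1 hi).2, (mem_sidePositions.1 (hf.right_mem hi)).2,
      hf.exponent_eq i hi⟩

end IsOppositeMatching

theorem hasOppositeWords_iff_exists_isOppositePairing :
    HasOppositeWords χ ω V ↔ ∃ π : Finpartition V, IsOppositePairing χ ω π := by
  rw [hasOppositeWords_iff_exists_isOppositeMatching]
  exact ⟨fun ⟨_, hf⟩ => ⟨_, hf.isOppositePairing_toFinpartition⟩,
    fun ⟨_, hπ⟩ => hπ.exists_isOppositeMatching.imp fun _ => And.left⟩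

open Classical in
theorem sum_prod_isOppositePair (V : Finset (Fin n)) :
    ∑ π : Finpartition V with IsBiNonCrossing χ π,
      ∏ W ∈ π.parts, (if IsOppositePair χ ω W then (1 : ℂ) else 0) =
    if HasOppositeWords χ ω V then 1 else 0 := by
  have prod_eq : ∀ π ∈ ({π | IsBiNonCrossing χ π} : Finset (Finpartition V)),
      ∏ W ∈ π.parts, (if IsOppositePair χ ω W then (1 : ℂ) else 0) =
        if IsOppositePairing χ ω π then 1 else 0 := fun π hπ => by
    rw [Finset.prod_boole]
    congr 1
    exact propext ⟨fun h => ⟨(Finset.mem_filter.1 hπ).2, h⟩, fun h => h.isOppositePair⟩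
  rw [Finset.sum_congr rfl prod_eq]
  split_ifs with h
  · obtain ⟨π, hπ⟩ := hasOppositeWords_iff_exists_isOppositePairing.1 h
    rw [Finset.sum_eq_single_of_mem π (by simpa using hπ.isBiNonCrossing), if_pos hπ]
    exact fun π' _ hne => if_neg fun hπ' => hne (hπ'.unique hπ)
  · exact Finset.sum_eq_zero fun π _ => if_neg fun hπ =>
      h (hasOppositeWords_iff_exists_isOppositePairing.2 ⟨π, hπ⟩)

end Pairings

section BalancedState

variable {n : ℕ} (χ : Fin n → Side) (ω : Fin n → Bool)

open FreeStarMonoid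

theorem isBalanced_prod_letter_iff (V : Finset (Fin n)) :
    IsBalanced (V.sort.map fun k => letter (χ k) (ω k)).prod ↔ HasOppositeWords χ ω V := by
  simp only [IsBalanced, exponents_prod_letter, filter_sort, HasOppositeWords, sideWord,
    sidePositions]

open Classical in
theorem balancedState_orderedProd (V : Finset (Fin n)) :
    balancedState (orderedProd (fun k => generator (χ k) (ω k)) V) =
      if HasOppositeWords χ ω V then 1 else 0 := by
  rw [orderedProd_generator, balancedState_single]
  exact if_congr (isBalanced_prod_letter_iff χ ω V) rfl rfl

theorem not_isOppositePair_empty : ¬ IsOppositePair χ ω ∅ := by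
  rintro ⟨i, j, h, -⟩
  exact Finset.insert_ne_empty i {j} h.symm

open Classical in
theorem biFreeCumulant_balancedState :
    biFreeCumulant balancedState χ
      (fun k => starLetter (generator .l false) (generator .r false) (χ k) (ω k)) =
    if IsOppositePair χ ω Finset.univ then 1 else 0 := by
  simp only [starLetter_generator]
  refine biFreeCumulantOn_eq_of_moment_eq (κ := fun V => if IsOppositePair χ ω V then 1 else 0)
    (if_neg (not_isOppositePair_empty χ ω)) (fun V => ?_) Finset.univ
  rw [balancedState_orderedProd, sum_prod_isOppositePair]

variable {χ ω}

theorem isOppositePair_univ_iff : IsOppositePair χ ω Finset.univ ↔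
    n = 2 ∧ ∀ i j, i ≠ j → χ i ≠ χ j ∧ ω i ≠ ω j := by
  constructor
  · rintro ⟨i, j, huniv, hi, hj, hω⟩
    have mem_pair : ∀ k, k = i ∨ k = j := fun k => by simpa [huniv] using Finset.mem_univ k
    have hij : i ≠ j := by grind
    refine ⟨by simpa [huniv, hij] using (Finset.card_univ (α := Fin n)).symm, fun k k' hk => ?_⟩
    rcases mem_pair k with rfl | rfl <;> rcases mem_pair k' with rfl | rfl <;> simp_all
  · rintro ⟨rfl, hne⟩
    obtain ⟨hχ, hω⟩ := hne 0 1 zero_ne_one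
    cases h0 : χ 0 <;> cases h1 : χ 1
    · exact absurd (h0.trans h1.symm) hχ
    · exact ⟨0, 1, rfl, h0, h1, Bool.eq_not.2 hω.symm⟩
    · exact ⟨1, 0, by decide, h1, h0, Bool.eq_not.2 hω⟩
    · exact absurd (h0.trans h1.symm) hχ

theorem biFreeCumulant_balancedState_eq_zero
    (h : ¬ (n = 2 ∧ ∀ i j, i ≠ j → χ i ≠ χ j ∧ ω i ≠ ω j)) :
    biFreeCumulant balancedState χ
      (fun k => starLetter (generator .l false) (generator .r false) (χ k) (ω k)) = 0 := by
  classical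
  rw [biFreeCumulant_balancedState, if_neg (mt isOppositePair_univ_iff.1 h)]

theorem biFreeCumulant_balancedState_pair (s t : Side) (e e' : Bool) (hst : s ≠ t)
    (he : e ≠ e') :
    biFreeCumulant balancedState ![s, t]
      ![starLetter (generator .l false) (generator .r false) s e,
        starLetter (generator .l false) (generator .r false) t e'] = 1 := by
  classical
  have hpair : IsOppositePair ![s, t] ![e, e'] Finset.univ :=
    isOppositePair_univ_iff.2 ⟨rfl, by simp [Fin.forall_fin_two, hst, hst.symm, he, he.symm]⟩
  rw [← (biFreeCumulant_balancedState ![s, t] ![e, e']).trans (if_pos hpair)]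
  congr 1
  ext k
  fin_cases k <;> rfl

theorem isRDiagonal_balancedState :
    IsRDiagonal balancedState (generator .l false) (generator .r false) := by
  refine fun n χ ω not_alternating => biFreeCumulant_balancedState_eq_zero ?_
  rintro ⟨rfl, hne⟩
  refine not_alternating ⟨even_two, fun i j hij _ => (hne i j ?_).2⟩
  rintro rfl
  cases hs : χ i <;> simp [chiLT, hs] at hij

end BalancedState

namespace StateSpace

variable {ι : Type*} [DecidableEq ι] (X : ι → StateSpace.{u})

theorem algebraMapInv_embed (i : ι) (v : (X i).carrier) :
    TensorAlgebra.algebraMapInv (embed X i v) = (X i).ψ v := by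
  simp [embed, letter, TensorAlgebra.algebraMapInv]

theorem leftFock_embed_ne {i j : ι} (hij : j ≠ i) (T : Module.End ℂ (X i).carrier)
    (v : (X j).carrier) :
    leftFock X i T (embed X j v) = embed X i (T (X i).ξ) * embed X j v := by
  have letter_case := leftFock_letter_ne X hij T ((X j).toCompl v) 1
  rw [mul_one] at letter_case
  have embed_eq : embed X j v = (X j).ψ v • 1 + letter X j ((X j).toCompl v) := by
    simp [embed, Algebra.algebraMap_eq_smul_one]
  rw [embed_eq, map_add, map_smul, leftFock_one, letter_case, mul_add, mul_smul_comm, mul_one]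

theorem vacuumCoeff_leftOp (i : ι) (T : Module.End ℂ (X i).carrier) :
    vacuumCoeff X (leftOp X i T (vacuum X)) = (X i).ψ (T (X i).ξ) := by
  change TensorAlgebra.algebraMapInv (leftFock X i T 1) = _
  rw [leftFock_one, algebraMapInv_embed]

theorem vacuumCoeff_rightOp (i : ι) (T : Module.End ℂ (X i).carrier) :
    vacuumCoeff X (rightOp X i T (vacuum X)) = (X i).ψ (T (X i).ξ) := by
  change TensorAlgebra.algebraMapInv (rightFock X i T 1) = _
  rw [rightFock_one, algebraMapInv_embed]

theorem vacuumCoeff_leftOp_rightOp {i j : ι} (hij : i ≠ j) (T : Module.End ℂ (X i).carrier)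
    (S : Module.End ℂ (X j).carrier) :
    vacuumCoeff X (leftOp X i T (rightOp X j S (vacuum X))) =
      (X i).ψ (T (X i).ξ) * (X j).ψ (S (X j).ξ) := by
  change TensorAlgebra.algebraMapInv (leftFock X i T (rightFock X j S 1)) = _
  rw [rightFock_one, leftFock_embed_ne X hij.symm, map_mul, algebraMapInv_embed,
    algebraMapInv_embed]

end StateSpace

section BiFree

variable {A : Type*} [Ring A] [Algebra ℂ A] {φ : A →ₗ[ℂ] ℂ}

theorem IsBiFree.map_mul {ι : Type*} [DecidableEq ι] {B C : ι → Subalgebra ℂ A}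
    (h : IsBiFree φ B C) {i j : ι} (hij : i ≠ j) (b : B i) (c : C j) :
    φ (b * c) = φ b * φ c := by
  obtain ⟨X, l, r, moment_eq⟩ := h
  have hbc := moment_eq [⟨i, Sum.inl b⟩, ⟨j, Sum.inr c⟩]
  have hb := moment_eq [⟨i, Sum.inl b⟩]
  have hc := moment_eq [⟨j, Sum.inr c⟩]
  simp only [List.map_cons, List.map_nil, List.prod_cons, List.prod_nil, mul_one,
    Module.End.mul_apply] at hbc hb hc
  rw [hbc, hb, hc, StateSpace.vacuumCoeff_leftOp_rightOp X hij, StateSpace.vacuumCoeff_leftOp,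
    StateSpace.vacuumCoeff_rightOp]

theorem AreBiFreePairs.map_mul {p q : A × A} (h : AreBiFreePairs φ p q) :
    φ (p.1 * q.2) = φ p.1 * φ q.2 :=
  IsBiFree.map_mul h (i := 0) (j := 1) zero_ne_one
    ⟨p.1, Algebra.subset_adjoin rfl⟩ ⟨q.2, Algebra.subset_adjoin rfl⟩

end BiFree

open FreeStarMonoid in
theorem not_areBiFreePairs_balancedState :
    ¬ AreBiFreePairs balancedState
      (generator .l false * star (generator .l false),
        generator .r false * star (generator .r false))
      (star (generator .l false) * generator .l false,
        star (generator .r false) * generator .r false) := by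
  intro h
  have left_moment : balancedState (generator .l false * star (generator .l false)) = 0 := by
    simp only [star_generator]
    simp [generator, MonoidAlgebra.single_mul_single, balancedState_single, IsBalanced, exponents]
  have mixed_moment : balancedState (generator .l false * star (generator .l false) *
      (star (generator .r false) * generator .r false)) = 1 := by
    simp only [star_generator]
    simp [generator, MonoidAlgebra.single_mul_single, balancedState_single, IsBalanced, exponents]
  have factorization := h.map_mul
  rw [mixed_moment, left_moment, zero_mul] at factorization
  exact one_ne_zero factorization

theorem theorem2p7 :
    ∃ (A : Type) (_ : Ring A) (_ : StarRing A) (_ : Algebra ℂ A) (_ : StarModule ℂ A)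
      (φ : A →ₗ[ℂ] ℂ) (x y : A),
      IsStarProbability φ ∧
      IsRDiagonal φ x y ∧
      ¬ AreBiFreePairs φ (x * star x, y * star y) (star x * x, star y * y) ∧
      biFreeCumulant φ ![Side.l, Side.r] ![x, star y] = 1 ∧
      biFreeCumulant φ ![Side.l, Side.r] ![star x, y] = 1 ∧
      biFreeCumulant φ ![Side.r, Side.l] ![y, star x] = 1 ∧
      biFreeCumulant φ ![Side.r, Side.l] ![star y, x] = 1 ∧
      ∀ (n : ℕ) (χ : Fin n → Side) (ω : Fin n → Bool), 0 < n →
        ¬ (n = 2 ∧ ∀ i j, i ≠ j → χ i ≠ χ j ∧ ω i ≠ ω j) →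
        biFreeCumulant φ χ (fun k => starLetter x y (χ k) (ω k)) = 0 :=
  ⟨MonoidAlgebra ℂ (FreeStarMonoid Side), inferInstance, inferInstance, inferInstance,
    inferInstance, balancedState, FreeStarMonoid.generator .l false,
    FreeStarMonoid.generator .r false, isStarProbability_balancedState,
    isRDiagonal_balancedState, not_areBiFreePairs_balancedState,
    biFreeCumulant_balancedState_pair .l .r false true (by decide) (by decide),
    biFreeCumulant_balancedState_pair .l .r true false (by decide) (by decide),
    biFreeCumulant_balancedState_pair .r .l false true (by decide) (by decide),
    biFreeCumulant_balancedState_pair .r .l true false (by decide) (by decide),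
    fun _ _ _ _ h => biFreeCumulant_balancedState_eq_zero h⟩
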